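/- For $k\ge 1$ let $S_k$ and $A_k$ be the symmetric and alternating groups on $k$ letters. For $\sigma,\tau\in S_k$ let $\mathcal A_{\sigma,\tau}$ be the two-state cyclic Mealy automaton over the alphabet $\Sigma=\{1,\dots,k\}$: its states are $0,1$, every letter moves each state to the other one, and the states $0$ and $1$ have production functions $\rho_0=\sigma$ and $\rho_1=\tau$. The production functions are extended to words over $\Sigma$ by $\rho_q(a\mathbf{s})=\rho_q(a)\,\rho_{1-q}(\mathbf{s})$ for $a\in\Sigma$, and $\langle\mathcal A_{\sigma,\tau}\rangle$ is the group of permutations of $\Sigma^*$ generated by $\rho_0$ and $\rho_1$. Let $\langle(\sigma,\tau)\rangle_c=\langle(\sigma,\tau),(\tau,\sigma)\rangle\le S_k\times S_k$ be the group circularly generated by $(\sigma,\tau)$. Let $k>5$ and let $\sigma,\tau\in S_k$ have different orders and satisfy $\langle\sigma,\tau\rangle=S_k$ or $\langle\sigma,\tau\rangle=A_k$. Then $\langle\mathcal A_{\sigma,\tau}\rangle=\langle(\sigma,\tau)\rangle_c$, where $S_k\times S_k$ is identified with a group of permutations of $\Sigma^*$ through the faithful action in which $(\alpha,\beta)$ applies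 $\alpha$ to the 1st, 3rd, 5th, … letters and $\beta$ to the 2nd, 4th, 6th, … letters of a word. Moreover, as subgroups of $S_k\times S_k$, \[ \langle(\sigma,\tau)\rangle_c=\begin{cases} S_k\times S_k & \text{if } \operatorname{sgn}\sigma\neq\operatorname{sgn}\tau,\\ (A_k\times A_k)\rtimes\langle(\pi,\pi)\rangle & \text{if } \operatorname{sgn}\sigma=\operatorname{sgn}\tau=-1,\\ A_k\times A_k & \text{if } \operatorname{sgn}\sigma=\operatorname{sgn}\tau=1, \end{cases} \] where $\pi$ is an arbitrary transposition of $S_k$ and $\rtimes$ denotes the inner semidirect product. -/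

import Mathlib

open Equiv

/-- An invertible Mealy automaton with stateset `Q` and alphabet `α`: every letter `a` induces a
transition map `δ a : Q → Q`, and every state `q` a permutation `ρ q` of the alphabet. -/
structure InvertibleMealyAutomaton (Q α : Type*) where
  δ : α → Q → Q
  ρ : Q → Perm α

namespace InvertibleMealyAutomaton

variable {Q α : Type*} (A : InvertibleMealyAutomaton Q α)

/-- The production function extended to words: `ρ_q (a w) = ρ_q(a) ρ_{δ_a(q)}(w)`. -/
def act : Q → List α → List α
  | _, [] => []
  | q, a :: w => A.ρ q a :: act (A.δ a q) w

/-- The inverse of `act q`. -/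
def actInv : Q → List α → List α
  | _, [] => []
  | q, b :: w => (A.ρ q).symm b :: actInv (A.δ ((A.ρ q).symm b) q) w

theorem actInv_act (q : Q) (w : List α) : A.actInv q (A.act q w) = w := by
  induction w generalizing q with
  | nil => rfl
  | cons a w ih => simp [act, actInv, ih]

theorem act_actInv (q : Q) (w : List α) : A.act q (A.actInv q w) = w := by
  induction w generalizing q with
  | nil => rfl
  | cons a w ih => simp [act, actInv, ih]

/-- The production function of the state `q`, as a permutation of the set of words. -/
def actPerm (q : Q) : Perm (List α) where
  toFun := A.act q
  invFun := A.actInv q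
  left_inv := A.actInv_act q
  right_inv := A.act_actInv q

/-- The group generated by the automaton: the group of permutations of the set of words that is
generated by the production functions of the states. -/
def generatedGroup : Subgroup (Perm (List α)) :=
  Subgroup.closure (Set.range A.actPerm)

end InvertibleMealyAutomaton

/-- The cyclic automaton with states `0, …, n - 1` and productions `ρ 0, …, ρ (n - 1)`: every
letter sends the state `q` to the state `q + 1` modulo `n`. -/
def cyclicAutomaton {n : ℕ} [NeZero n] {α : Type*} (ρ : Fin n → Perm α) :
    InvertibleMealyAutomaton (Fin n) α where
  δ := fun _ q => q + 1
  ρ := ρ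

/-- The group circularly generated by `(ρ 0, …, ρ (n - 1))`: the subgroup of `G ^ n` generated by
all the circular shifts `(ρ j, ρ (j + 1), …, ρ (j + n - 1))` of the tuple. -/
def circularlyGenerated {n : ℕ} [NeZero n] {G : Type*} [Group G] (ρ : Fin n → G) :
    Subgroup (Fin n → G) :=
  Subgroup.closure (Set.range fun j : Fin n => fun i : Fin n => ρ (j + i))

theorem mapIdx_id_aux {α : Type*} (w : List α) : w.mapIdx (fun _ a => a) = w := by
  apply List.ext_getElem <;> simp

/-- The action of `n`-tuples of permutations of the alphabet on words: the letter in position `i`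
(counted from `0`) is moved by the coordinate of index `i` modulo `n`. -/
def tupleAction (n : ℕ) [NeZero n] (α : Type*) : (Fin n → Perm α) →* Perm (List α) where
  toFun g :=
    { toFun := fun w => w.mapIdx fun i a => g (Fin.ofNat n i) a
      invFun := fun w => w.mapIdx fun i a => (g (Fin.ofNat n i))⁻¹ a
      left_inv := fun w => by simp [List.mapIdx_mapIdx, Function.comp_def, mapIdx_id_aux]
      right_inv := fun w => by simp [List.mapIdx_mapIdx, Function.comp_def, mapIdx_id_aux] }
  map_one' := by ext1 w; simp [mapIdx_id_aux]
  map_mul' g h := by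
    ext1 w
    simp [List.mapIdx_mapIdx, Function.comp_def, mapIdx_id_aux]

/-- `H` is the inner semidirect product `N ⋊ K` of its subgroups `N` (normal in `H`) and `K`. -/
structure IsInnerSemidirectProduct {G : Type*} [Group G] (H N K : Subgroup G) : Prop where
  sup_eq : N ⊔ K = H
  inf_eq : N ⊓ K = ⊥
  normal : (N.subgroupOf H).Normal

/-- `A_k × A_k`, as a subgroup of `S_k × S_k`. -/
def alternatingSquare (k : ℕ) : Subgroup (Fin 2 → Perm (Fin k)) :=
  Subgroup.pi Set.univ fun _ => alternatingGroup (Fin k)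

/-! Transitions ignore the letter read, so from state `q` the letter in position `i` is permuted by
`ρ (q + i)`: each production function is the action of a circular shift of the tuple, and the two
groups agree. For the structure, unequal orders make some power of `(σ, τ)` trivial in exactly one
coordinate; the swapped generator gives the same element in the other coordinate. Each coordinate
projection is onto `⟨σ, τ⟩`, so conjugation and the normal subgroup structure of `S_k` and `A_k`
(for `k ≥ 5`) yield `A_k × 1` and `1 × A_k`. Above `A_k × A_k`, the group is determined by the sign
pairs of its elements. -/

theorem tupleAction_injective (n : ℕ) [NeZero n] (α : Type*) :
    Function.Injective (tupleAction n α) := by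
  intro g h hgh
  funext i
  ext1 a
  -- A constant word of length `n` meets every coordinate once, so its letter `i` reads off `g i a`.
  have hw : (List.replicate n a).mapIdx (fun j b => g (Fin.ofNat n j) b) =
      (List.replicate n a).mapIdx (fun j b => h (Fin.ofNat n j) b) :=
    DFunLike.congr_fun hgh (List.replicate n a)
  have hi := congrArg (fun l => l[(i : ℕ)]?) hw
  simpa using hi

theorem cyclicAutomaton_act {n : ℕ} [NeZero n] {α : Type*} (ρ : Fin n → Perm α)
    (q : Fin n) (w : List α) :
    (cyclicAutomaton ρ).act q w = w.mapIdx fun i a => ρ (q + Fin.ofNat n i) a := by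
  induction w generalizing q with
  | nil => rfl
  | cons a w ih =>
    have hsucc (i : ℕ) : q + 1 + Fin.ofNat n i = q + Fin.ofNat n (i + 1) := by
      refine Fin.ext ?_
      simp [Fin.val_add, add_assoc, add_comm 1]
    rw [InvertibleMealyAutomaton.act, ih, List.mapIdx_cons]
    simp only [cyclicAutomaton, hsucc]
    simp

theorem cyclicAutomaton_actPerm {n : ℕ} [NeZero n] {α : Type*} (ρ : Fin n → Perm α)
    (q : Fin n) :
    (cyclicAutomaton ρ).actPerm q = tupleAction n α fun i => ρ (q + i) := by
  ext1 w
  exact cyclicAutomaton_act ρ q w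

theorem cyclicAutomaton_generatedGroup {n : ℕ} [NeZero n] {α : Type*} (ρ : Fin n → Perm α) :
    (cyclicAutomaton ρ).generatedGroup = (circularlyGenerated ρ).map (tupleAction n α) := by
  rw [circularlyGenerated, MonoidHom.map_closure, ← Set.range_comp,
    InvertibleMealyAutomaton.generatedGroup]
  congr 2
  funext q
  exact cyclicAutomaton_actPerm ρ q

section CircularlyGeneratedPair

variable {G : Type*} [Group G] (σ τ : G)

theorem pair_mem_circularlyGenerated : ![σ, τ] ∈ circularlyGenerated ![σ, τ] := by
  refine Subgroup.subset_closure ⟨0, ?_⟩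
  funext i
  simp

theorem swapped_pair_mem_circularlyGenerated : ![τ, σ] ∈ circularlyGenerated ![σ, τ] := by
  refine Subgroup.subset_closure ⟨1, ?_⟩
  funext i
  fin_cases i <;> rfl

variable {σ τ}

theorem circularlyGenerated_pair_le {K : Subgroup (Fin 2 → G)} (h : ![σ, τ] ∈ K)
    (h' : ![τ, σ] ∈ K) : circularlyGenerated ![σ, τ] ≤ K := by
  refine (Subgroup.closure_le K).2 ?_
  have e₀ : (fun i => ![σ, τ] (0 + i)) = ![σ, τ] := by simp
  have e₁ : (fun i => ![σ, τ] (1 + i)) = ![τ, σ] := by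
    funext i
    fin_cases i <;> rfl
  rw [Set.range_subset_iff, Fin.forall_fin_two, e₀, e₁]
  exact ⟨h, h'⟩

theorem exists_mem_circularlyGenerated_apply_eq (i : Fin 2) {h : G}
    (hh : h ∈ Subgroup.closure {σ, τ}) : ∃ g ∈ circularlyGenerated ![σ, τ], g i = h := by
  suffices Subgroup.closure {σ, τ} ≤
      (circularlyGenerated ![σ, τ]).map (Pi.evalMonoidHom (fun _ : Fin 2 => G) i) from this hh
  rw [Subgroup.closure_le, Set.pair_subset_iff]
  have h₀ := pair_mem_circularlyGenerated σ τ
  have h₁ := swapped_pair_mem_circularlyGenerated σ τ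
  fin_cases i
  · exact ⟨⟨_, h₀, rfl⟩, ⟨_, h₁, rfl⟩⟩
  · exact ⟨⟨_, h₁, rfl⟩, ⟨_, h₀, rfl⟩⟩

/-- Lift `h` to a member of the group with coordinate `i` equal to `h`; its other coordinate cancels
in the conjugation. -/
theorem conj_mulSingle_mem_circularlyGenerated (i : Fin 2) {h a : G}
    (hh : h ∈ Subgroup.closure {σ, τ})
    (ha : Pi.mulSingle i a ∈ circularlyGenerated ![σ, τ]) :
    Pi.mulSingle i (h * a * h⁻¹) ∈ circularlyGenerated ![σ, τ] := by
  obtain ⟨g, hg, rfl⟩ := exists_mem_circularlyGenerated_apply_eq i hh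
  convert mul_mem (mul_mem hg ha) (inv_mem hg) using 1
  funext j
  by_cases hj : j = i
  · subst hj
    simp
  · simp [hj]

/-- If `σ ^ orderOf τ` and `τ ^ orderOf σ` were both trivial, the orders would divide each other; a
nontrivial one serves as `a`. -/
theorem exists_mulSingle_mem_circularlyGenerated (hord : orderOf σ ≠ orderOf τ) :
    ∃ a ∈ Subgroup.closure {σ, τ}, a ≠ 1 ∧
      ∀ i : Fin 2, Pi.mulSingle i a ∈ circularlyGenerated ![σ, τ] := by
  have h₀ := pair_mem_circularlyGenerated σ τ
  have h₁ := swapped_pair_mem_circularlyGenerated σ τ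
  by_cases hσ : σ ^ orderOf τ = 1
  · have hτ : τ ^ orderOf σ ≠ 1 := fun hτ =>
      hord (Nat.dvd_antisymm (orderOf_dvd_of_pow_eq_one hσ) (orderOf_dvd_of_pow_eq_one hτ))
    refine ⟨_, pow_mem (Subgroup.subset_closure (by simp)) (orderOf σ), hτ, fun i => ?_⟩
    fin_cases i
    · convert pow_mem h₁ (orderOf σ) using 1
      funext j
      fin_cases j <;> simp [pow_orderOf_eq_one]
    · convert pow_mem h₀ (orderOf σ) using 1
      funext j
      fin_cases j <;> simp [pow_orderOf_eq_one]
  · refine ⟨_, pow_mem (Subgroup.subset_closure (by simp)) (orderOf τ), hσ, fun i => ?_⟩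
    fin_cases i
    · convert pow_mem h₀ (orderOf τ) using 1
      funext j
      fin_cases j <;> simp [pow_orderOf_eq_one]
    · convert pow_mem h₁ (orderOf τ) using 1
      funext j
      fin_cases j <;> simp [pow_orderOf_eq_one]

end CircularlyGeneratedPair

/-- A nontrivial subgroup of `H` normalized by `H`, where `H` is the symmetric or the alternating
group, contains the alternating group. -/
theorem alternatingGroup_le_of_conj_mem {α : Type*} [DecidableEq α] [Fintype α]
    (hα : 5 ≤ Nat.card α) {H N : Subgroup (Perm α)} (hH : H = ⊤ ∨ H = alternatingGroup α)
    (hconj : ∀ h ∈ H, ∀ a ∈ N, h * a * h⁻¹ ∈ N) {a : Perm α} (haH : a ∈ H) (haN : a ∈ N)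
    (ha : a ≠ 1) : alternatingGroup α ≤ N := by
  obtain rfl | rfl := hH
  · have : N.Normal := ⟨fun b hb h => hconj h trivial b hb⟩
    exact Perm.alternatingGroup_le_of_normal hα
      ((Subgroup.nontrivial_iff_exists_ne_one N).2 ⟨a, haN, ha⟩)
  · have : (N.subgroupOf (alternatingGroup α)).Normal :=
      ⟨fun b hb h => hconj h h.2 b hb⟩
    refine Subgroup.subgroupOf_eq_top.1 ?_
    refine (alternatingGroup.normal_subgroup_eq_bot_or_eq_top hα).resolve_left fun hbot => ha ?_
    have hmem : (⟨a, haH⟩ : alternatingGroup α) ∈ N.subgroupOf (alternatingGroup α) := haN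
    rw [hbot, Subgroup.mem_bot] at hmem
    exact congrArg Subtype.val hmem

theorem mem_alternatingSquare {k : ℕ} {g : Fin 2 → Perm (Fin k)} :
    g ∈ alternatingSquare k ↔ Perm.sign (g 0) = 1 ∧ Perm.sign (g 1) = 1 := by
  simp [alternatingSquare, Subgroup.mem_pi, Fin.forall_fin_two]

theorem alternatingSquare_normal (k : ℕ) : (alternatingSquare k).Normal := by
  refine ⟨fun n hn g => ?_⟩
  rw [mem_alternatingSquare] at hn ⊢
  simp [hn.1, hn.2]

theorem alternatingSquare_le_circularlyGenerated {k : ℕ} (hk : 5 ≤ k) {σ τ : Perm (Fin k)}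
    (hord : orderOf σ ≠ orderOf τ)
    (hgen : Subgroup.closure {σ, τ} = ⊤ ∨ Subgroup.closure {σ, τ} = alternatingGroup (Fin k)) :
    alternatingSquare k ≤ circularlyGenerated ![σ, τ] := by
  obtain ⟨a, haH, ha, hmem⟩ := exists_mulSingle_mem_circularlyGenerated hord
  refine Subgroup.pi_le_iff.2 fun i => Subgroup.map_le_iff_le_comap.2 ?_
  -- Here `N` is the preimage of the group under the embedding of coordinate `i`.
  exact alternatingGroup_le_of_conj_mem (by simpa using hk) hgen
    (fun h hh b hb => conj_mulSingle_mem_circularlyGenerated i hh hb) haH (hmem i) ha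

theorem circularlyGenerated_eq_top {k : ℕ} {σ τ : Perm (Fin k)}
    (hle : alternatingSquare k ≤ circularlyGenerated ![σ, τ])
    (hsign : Perm.sign σ ≠ Perm.sign τ) : circularlyGenerated ![σ, τ] = ⊤ := by
  have h₀ := pair_mem_circularlyGenerated σ τ
  have h₁ := swapped_pair_mem_circularlyGenerated σ τ
  -- Membership depends only on the sign pair, since `A_k × A_k` is the kernel of the coordinatewise
  -- sign.
  have key (x : Fin 2 → Perm (Fin k)) (hx : x ∈ circularlyGenerated ![σ, τ])
      (g : Fin 2 → Perm (Fin k)) (e₀ : Perm.sign (g 0) = Perm.sign (x 0))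
      (e₁ : Perm.sign (g 1) = Perm.sign (x 1)) : g ∈ circularlyGenerated ![σ, τ] := by
    have : g * x⁻¹ ∈ alternatingSquare k := by
      rw [mem_alternatingSquare]
      simp [e₀, e₁]
    simpa using mul_mem (hle this) hx
  rw [eq_top_iff]
  rintro g -
  rcases Int.units_eq_one_or (Perm.sign (g 0)) with e₀ | e₀ <;>
  rcases Int.units_eq_one_or (Perm.sign (g 1)) with e₁ | e₁ <;>
  rcases Int.units_eq_one_or (Perm.sign σ) with eσ | eσ <;>
  rcases Int.units_eq_one_or (Perm.sign τ) with eτ | eτ <;>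
  -- The four sign pairs are realized by `1`, `(σ, τ)`, `(τ, σ)` and the product of the last two.
  first
  | exact absurd (eσ.trans eτ.symm) hsign
  | (refine key _ (one_mem _) g ?_ ?_ <;> simp [e₀, e₁]; done)
  | (refine key _ h₀ g ?_ ?_ <;> simp [e₀, e₁, eσ, eτ]; done)
  | (refine key _ h₁ g ?_ ?_ <;> simp [e₀, e₁, eσ, eτ]; done)
  | (refine key _ (mul_mem h₀ h₁) g ?_ ?_ <;> simp [e₀, e₁, eσ, eτ])

theorem circularlyGenerated_isInnerSemidirectProduct {k : ℕ} {σ τ : Perm (Fin k)}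
    (hle : alternatingSquare k ≤ circularlyGenerated ![σ, τ])
    (hσ : Perm.sign σ = -1) (hτ : Perm.sign τ = -1) {π : Perm (Fin k)} (hπ : π.IsSwap) :
    IsInnerSemidirectProduct (circularlyGenerated ![σ, τ]) (alternatingSquare k)
      (Subgroup.closure {![π, π]}) := by
  have hsign := hπ.sign_eq
  refine ⟨le_antisymm (sup_le hle ?_) ?_, ?_, (alternatingSquare_normal k).comap _⟩
  · rw [Subgroup.closure_le, Set.singleton_subset_iff]
    have : ![π, π] * (![σ, τ])⁻¹ ∈ alternatingSquare k := by
      rw [mem_alternatingSquare]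
      simp [hsign, hσ, hτ]
    simpa using mul_mem (hle this) (pair_mem_circularlyGenerated σ τ)
  · have key (x : Fin 2 → Perm (Fin k)) (e₀ : Perm.sign (x 0) = -1)
        (e₁ : Perm.sign (x 1) = -1) :
        x ∈ alternatingSquare k ⊔ Subgroup.closure {![π, π]} := by
      have : x * (![π, π])⁻¹ ∈ alternatingSquare k := by
        rw [mem_alternatingSquare]
        simp [hsign, e₀, e₁]
      simpa using Subgroup.mul_mem_sup this (Subgroup.mem_closure_singleton_self ![π, π])
    exact circularlyGenerated_pair_le (key _ hσ hτ) (key _ hτ hσ)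
  · have hsq : ![π, π] * ![π, π] = 1 := by
      obtain ⟨x, y, -, rfl⟩ := hπ
      funext i
      fin_cases i <;> simp
    rw [eq_bot_iff]
    rintro g ⟨hg, hg'⟩
    obtain ⟨n, rfl⟩ := Subgroup.mem_closure_singleton.1 hg'
    -- Even powers of `(π, π)` are trivial; odd ones equal `(π, π)`, whose coordinates are odd
    -- permutations.
    obtain ⟨m, rfl | rfl⟩ := n.even_or_odd'
    · rw [Subgroup.mem_bot, zpow_mul, zpow_two, hsq, one_zpow]
    · rw [zpow_add_one, zpow_mul, zpow_two, hsq, one_zpow, one_mul] at hg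
      have h := (mem_alternatingSquare.1 hg).1
      simp [hsign] at h

theorem circularlyGenerated_eq_alternatingSquare {k : ℕ} {σ τ : Perm (Fin k)}
    (hle : alternatingSquare k ≤ circularlyGenerated ![σ, τ])
    (hσ : Perm.sign σ = 1) (hτ : Perm.sign τ = 1) :
    circularlyGenerated ![σ, τ] = alternatingSquare k :=
  le_antisymm (circularlyGenerated_pair_le (mem_alternatingSquare.2 ⟨hσ, hτ⟩)
    (mem_alternatingSquare.2 ⟨hτ, hσ⟩)) hle

theorem mainTheorem3 (k : ℕ) (hk : 5 < k) (σ τ : Perm (Fin k))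
    (hord : orderOf σ ≠ orderOf τ)
    (hgen : Subgroup.closure {σ, τ} = ⊤ ∨ Subgroup.closure {σ, τ} = alternatingGroup (Fin k)) :
    -- the group of the two-state cyclic automaton is, as a group acting on words,
    -- the circularly generated group
    (Function.Injective (tupleAction 2 (Fin k)) ∧
      (cyclicAutomaton ![σ, τ]).generatedGroup =
        (circularlyGenerated ![σ, τ]).map (tupleAction 2 (Fin k))) ∧
    (Perm.sign σ ≠ Perm.sign τ → circularlyGenerated ![σ, τ] = ⊤) ∧
    (Perm.sign σ = -1 → Perm.sign τ = -1 → ∀ π : Perm (Fin k), π.IsSwap →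
      IsInnerSemidirectProduct (circularlyGenerated ![σ, τ]) (alternatingSquare k)
        (Subgroup.closure {![π, π]})) ∧
    (Perm.sign σ = 1 → Perm.sign τ = 1 →
      circularlyGenerated ![σ, τ] = alternatingSquare k) := by
  have hle := alternatingSquare_le_circularlyGenerated hk.le hord hgen
  exact ⟨⟨tupleAction_injective 2 (Fin k), cyclicAutomaton_generatedGroup _⟩,
    circularlyGenerated_eq_top hle,
    fun hσ hτ _ hπ => circularlyGenerated_isInnerSemidirectProduct hle hσ hτ hπ,
    circularlyGenerated_eq_alternatingSquare hle⟩
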